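/- Let $(\Omega,\mathcal F,\mathbb P)$ be a probability space and $\mathcal G\subseteq\mathcal F$ a sub-$\sigma$-algebra; random variables are identified when they are equal $\mathbb P$-a.s., and (in)equalities are $\mathbb P$-a.s. unless another measure is indicated. Let $L_{\mathcal F}\subseteq L^0(\Omega,\mathcal F,\mathbb P)$ and $L_{\mathcal G}\subseteq L^0(\Omega,\mathcal G,\mathbb P)$ be vector lattices such that $X\mathbf 1_A\in L_{\mathcal F}$ for $X\in L_{\mathcal F}$, $A\in\mathcal F$, and $Y\mathbf 1_A\in L_{\mathcal G}$ for $Y\in L_{\mathcal G}$, $A\in\mathcal G$. Let $L_{\mathcal F}^*$ be the order continuous dual of $L_{\mathcal F}$, i.e. the space of linear functionals $\varphi:L_{\mathcal F}\to\mathbb R$ with $\varphi(x_\alpha)\to0$ for every net $(x_\alpha)$ that order converges to $0$ in $L_{\mathcal F}$. Assume that * $L_{\mathcal F}^*\subseteq L^1(\Omega,\mathcal F,\mathbb P)$, i.e. every $\varphi\in L^*_{\mathcal F}$ has the form $\varphi(\xi)=E_{\mathbb P}[Z\xi]$ (with $Z\xi$ integrable for all $\xi\in L_{\mathcal F}$)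 for some $Z\in L^1(\Omega,\mathcal F,\mathbb P)$; we write $Z\in L_{\mathcal F}^*$ for such $Z$; and $Z\mathbf 1_A\in L_{\mathcal F}^*$ whenever $Z\in L_{\mathcal F}^*$ and $A\in\mathcal F$; * $L_{\mathcal F}^*$ separates the points of $L_{\mathcal F}$. Let $\sigma(L_{\mathcal F},L_{\mathcal F}^*)$ be the corresponding weak topology, and let $L_{\mathcal F}^*\cap\mathcal P_{\mathcal G}$ be the set of probability measures $Q\ll\mathbb P$ on $\mathcal F$ with $\frac{dQ}{d\mathbb P}\in L_{\mathcal F}^*$ and $Q=\mathbb P$ on $\mathcal G$. Assume that this set is non-empty (which holds, for instance, if $L_{\mathcal F}\subseteq L^1(\Omega,\mathcal F,\mathbb P)$, since then it contains $\mathbb P$). Let $\pi:L_{\mathcal F}\to L_{\mathcal G}$ be * monotone: $X\le Y$ implies $\pi(X)\le\pi(Y)$; * quasiconvex: $\pi(\Lambda X+(1-\Lambda)Y)\le\pi(X)\vee\pi(Y)$ for all $X,Y\in L_{\mathcal F}$ and $\mathcal G$-measurable $0\le\Lambda\le1$ with $\Lambda X+(1-\Lambda)Y\in L_{\mathcal F}$;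 * regular: $\pi(X\mathbf 1_A+Y\mathbf 1_{A^C})=\pi(X)\mathbf 1_A+\pi(Y)\mathbf 1_{A^C}$ for all $X,Y\in L_{\mathcal F}$, $A\in\mathcal G$; * $\sigma(L_{\mathcal F},L_{\mathcal F}^*)$-lower semicontinuous: $\{\xi\in L_{\mathcal F}\mid\pi(\xi)\le Y\}$ is $\sigma(L_{\mathcal F},L_{\mathcal F}^*)$-closed for every $Y\in L_{\mathcal G}$. For $X\in L_{\mathcal F}$ and $Q\in L_{\mathcal F}^*\cap\mathcal P_{\mathcal G}$ define the extended real valued random variable $$K(X,Q):=\operatorname*{ess\,inf}_{\xi\in L_{\mathcal F}}\left\{\pi(\xi)\;\middle|\;E_Q[\xi\mid\mathcal G]\ge E_Q[X\mid\mathcal G]\ \ Q\text{-a.s.}\right\}.$$ Let $X\in L_{\mathcal F}$ and suppose there are $\eta\in L_{\mathcal F}$ and a real $\delta>0$ with $\mathbb P(\pi(\eta)+\delta<\pi(X))=1$. Then, $\mathbb P$-a.s., $$\pi(X)=\operatorname*{ess\,sup}_{Q\in L_{\mathcal F}^*\cap\mathcal P_{\mathcal G}}K(X,Q).$$ -/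

import Mathlib

open MeasureTheory Filter Topology

namespace QuasiconvexDual

universe u

/-! ### Essential suprema and infima of families of extended real random variables -/

section EssentialBounds

variable {Ω : Type u} [mΩ : MeasurableSpace Ω]

theorem exists_isLUB_of_countable (P : Measure Ω) {C : Set (Ω →ₘ[P] EReal)} (hC : C.Countable) :
    ∃ g, IsLUB C g := by
  rcases C.eq_empty_or_nonempty with rfl | hne
  · refine ⟨AEEqFun.const Ω ⊥, by simp, fun g _ => ?_⟩
    rw [← AEEqFun.coeFn_le]
    filter_upwards [AEEqFun.coeFn_const Ω (μ := P) (⊥ : EReal)] with ω h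
    rw [h]
    exact bot_le
  · obtain ⟨f, rfl⟩ := hC.exists_eq_range hne
    have hm : AEStronglyMeasurable (fun ω => ⨆ n, f n ω) P :=
      (Measurable.iSup fun n => (f n).measurable).aestronglyMeasurable
    refine ⟨AEEqFun.mk _ hm, ?_, fun g hg => ?_⟩
    · rintro _ ⟨n, rfl⟩
      rw [← AEEqFun.coeFn_le]
      filter_upwards [AEEqFun.coeFn_mk _ hm] with ω h
      rw [h]
      exact le_iSup (fun n => f n ω) n
    · rw [← AEEqFun.coeFn_le]
      have h2 : ∀ᵐ ω ∂P, ∀ n, f n ω ≤ g ω :=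
        ae_all_iff.2 fun n => AEEqFun.coeFn_le.2 (hg ⟨n, rfl⟩)
      filter_upwards [AEEqFun.coeFn_mk _ hm, h2] with ω h h2
      rw [h]
      exact iSup_le h2

/-- A strictly increasing map of the extended reals into `[0, 1]`. -/
noncomputable def squash (x : EReal) : ENNReal := (1 + EReal.exp (-x))⁻¹

theorem squash_strictMono : StrictMono squash := by
  intro x y h
  unfold squash
  rw [ENNReal.inv_lt_inv]
  exact ENNReal.add_lt_add_left (by simp) (EReal.exp_strictMono (EReal.neg_lt_neg_iff.2 h))

theorem squash_le_one (x : EReal) : squash x ≤ 1 := by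
  unfold squash
  rw [ENNReal.inv_le_one]
  exact le_self_add

/-- Every family of extended real random variables has an essential supremum. -/
theorem exists_isLUB (P : Measure Ω) [IsFiniteMeasure P] (S : Set (Ω →ₘ[P] EReal)) :
    ∃ g, IsLUB S g := by
  let J : (Ω →ₘ[P] EReal) → ENNReal := fun g => ∫⁻ ω, squash (g ω) ∂P
  have hJfin : ∀ g, J g ≠ ⊤ := fun g => by
    have : J g ≤ ∫⁻ _, 1 ∂P := lintegral_mono fun ω => squash_le_one _
    exact ne_top_of_le_ne_top (by simp) this
  have hJmono : ∀ {g g' : Ω →ₘ[P] EReal}, g ≤ g' → J g ≤ J g' := fun h =>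
    lintegral_mono_ae ((AEEqFun.coeFn_le.2 h).mono fun ω hω => squash_strictMono.monotone hω)
  have hJeq : ∀ {g g' : Ω →ₘ[P] EReal}, g ≤ g' → J g' ≤ J g → g' ≤ g := by
    intro g g' h h'
    have hmeas : Measurable fun ω => squash (g' ω) :=
      squash_strictMono.monotone.measurable.comp g'.measurable
    have := ae_eq_of_ae_le_of_lintegral_le
      ((AEEqFun.coeFn_le.2 h).mono fun ω hω => squash_strictMono.monotone hω)
      (hJfin g) hmeas.aemeasurable h'
    rw [← AEEqFun.coeFn_le]
    filter_upwards [this] with ω hω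
    exact (squash_strictMono.injective hω).ge
  let T : Set (Ω →ₘ[P] EReal) := {g | ∃ C ⊆ S, C.Countable ∧ IsLUB C g}
  have hT : (J '' T).Nonempty := by
    obtain ⟨g, hg⟩ := exists_isLUB_of_countable P (C := ∅) Set.countable_empty
    exact ⟨J g, g, ⟨∅, Set.empty_subset _, Set.countable_empty, hg⟩, rfl⟩
  obtain ⟨v, -, hv, hvT⟩ := exists_seq_tendsto_sSup hT (OrderTop.bddAbove _)
  choose w hwT hwv using hvT
  choose C hCS hCc hCw using hwT
  have hUc : (⋃ n, C n).Countable := Set.countable_iUnion hCc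
  obtain ⟨g, hg⟩ := exists_isLUB_of_countable P hUc
  have hgS : sSup (J '' T) ≤ J g := by
    refine le_of_tendsto' hv fun n => ?_
    rw [← hwv]
    exact hJmono ((hCw n).2 fun x hx => hg.1 (Set.mem_iUnion.2 ⟨n, hx⟩))
  refine ⟨g, fun h hh => ?_, fun b hb => hg.2 fun x hx => ?_⟩
  · obtain ⟨g', hg'⟩ := exists_isLUB_of_countable P (hUc.insert h)
    have h1 : g ≤ g' := hg.2 fun x hx => hg'.1 (Set.mem_insert_of_mem _ hx)
    have hg'T : g' ∈ T := ⟨_, Set.insert_subset hh (Set.iUnion_subset hCS), hUc.insert h, hg'⟩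
    have h2 : J g' ≤ J g := (le_sSup (Set.mem_image_of_mem J hg'T)).trans hgS
    exact (hg'.1 (Set.mem_insert _ _)).trans (hJeq h1 h2)
  · obtain ⟨n, hn⟩ := Set.mem_iUnion.1 hx
    exact hb (hCS n hn)

/-- The `P`-essential supremum of a family of extended real random variables: the least upper
bound for the `P`-almost sure order (`⊥` for the empty family). -/
noncomputable def esssup {P : Measure Ω} [IsFiniteMeasure P] (S : Set (Ω →ₘ[P] EReal)) :
    Ω →ₘ[P] EReal :=
  (exists_isLUB P S).choose

theorem isLUB_esssup {P : Measure Ω} [IsFiniteMeasure P] (S : Set (Ω →ₘ[P] EReal)) :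
    IsLUB S (esssup S) :=
  (exists_isLUB P S).choose_spec

/-- The `P`-essential infimum of a family of extended real random variables: the greatest lower
bound for the `P`-almost sure order (`⊤` for the empty family). -/
noncomputable def essinf {P : Measure Ω} [IsFiniteMeasure P] (S : Set (Ω →ₘ[P] EReal)) :
    Ω →ₘ[P] EReal :=
  esssup (lowerBounds S)

theorem isGLB_essinf {P : Measure Ω} [IsFiniteMeasure P] (S : Set (Ω →ₘ[P] EReal)) :
    IsGLB S (essinf S) :=
  isLUB_lowerBounds.1 (isLUB_esssup _)

/-- A real random variable regarded as an extended real one. -/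
noncomputable def toEReal {P : Measure Ω} (f : Ω →ₘ[P] ℝ) : Ω →ₘ[P] EReal :=
  AEEqFun.comp (fun r : ℝ => (r : EReal)) continuous_coe_real_ereal f

/-- The class of the indicator function of a measurable set. -/
noncomputable def ind (P : Measure Ω) (A : Set Ω) (hA : MeasurableSet A) : Ω →ₘ[P] ℝ :=
  AEEqFun.mk (A.indicator fun _ => (1 : ℝ)) (measurable_const.indicator hA).aestronglyMeasurable

end EssentialBounds

/-! ### Spaces of random variables -/

section Spaces

variable {Ω : Type u}

/-- `L` is a vector lattice of (classes of) `𝒢`-measurable random variables, and it is stable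
under multiplication by indicators of sets of `𝒢`. -/
structure IsRandomLattice (𝒢 : MeasurableSpace Ω) [mΩ : MeasurableSpace Ω] (h𝒢 : 𝒢 ≤ mΩ)
    {P : Measure Ω} (L : Submodule ℝ (Ω →ₘ[P] ℝ)) : Prop where
  measurable : ∀ f ∈ L, AEStronglyMeasurable[𝒢] f P
  sup_mem : ∀ f ∈ L, ∀ g ∈ L, f ⊔ g ∈ L
  inf_mem : ∀ f ∈ L, ∀ g ∈ L, f ⊓ g ∈ L
  mul_ind_mem : ∀ f ∈ L, ∀ (A : Set Ω) (hA : MeasurableSet[𝒢] A), f * ind P A (h𝒢 A hA) ∈ L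

variable [mΩ : MeasurableSpace Ω] {P : Measure Ω}

/-- Order convergence to `0` of a net in the ordered space `L`: the absolute values are dominated
by a net of `L` with the same index set that decreases to `0` in `L`. -/
def OrderTendstoZero (L : Submodule ℝ (Ω →ₘ[P] ℝ)) {ι : Type u} [Preorder ι] (x : ι → L) : Prop :=
  ∃ y : ι → L, Antitone y ∧ IsGLB (Set.range y) 0 ∧
    ∀ i, |(x i : Ω →ₘ[P] ℝ)| ≤ (y i : Ω →ₘ[P] ℝ)

/-- A linear functional is order continuous if it maps nets that order converge to `0` to nets
that converge to `0`. (Directed index sets in the universe of `Ω` are enough, since `L` itself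
lives in that universe.) -/
def IsOrderContinuous (L : Submodule ℝ (Ω →ₘ[P] ℝ)) (φ : L →ₗ[ℝ] ℝ) : Prop :=
  ∀ (ι : Type u) [Preorder ι] [IsDirectedOrder ι] [Nonempty ι] (x : ι → L),
    OrderTendstoZero L x → Tendsto (fun i => φ (x i)) atTop (𝓝 0)

/-- The order continuous dual of `L`. -/
def orderContinuousDual (L : Submodule ℝ (Ω →ₘ[P] ℝ)) : Submodule ℝ (L →ₗ[ℝ] ℝ) where
  carrier := {φ | IsOrderContinuous L φ}
  add_mem' := by
    intro φ ψ hφ hψ ι _ _ _ x hx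
    simpa using (hφ ι x hx).add (hψ ι x hx)
  zero_mem' := by
    intro ι _ _ _ x hx
    simp
  smul_mem' := by
    intro c φ hφ ι _ _ _ x hx
    simpa using (hφ ι x hx).const_mul c

/-- The weak topology on `L` induced by its order continuous dual. -/
abbrev weakTopology (L : Submodule ℝ (Ω →ₘ[P] ℝ)) : TopologicalSpace L :=
  TopologicalSpace.induced (fun (ξ : L) (φ : orderContinuousDual L) => φ.1 ξ) Pi.topologicalSpace

/-- `Z` represents the functional `φ` on `L`: `Z` is in `L¹(P)` and `φ ξ = E_P[Z ξ]` (with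
integrable product) for every `ξ` in `L`. -/
def Represents (L : Submodule ℝ (Ω →ₘ[P] ℝ)) (Z : Ω → ℝ) (φ : L →ₗ[ℝ] ℝ) : Prop :=
  Integrable Z P ∧ ∀ ξ : L, Integrable (fun ω => Z ω * (ξ : Ω →ₘ[P] ℝ) ω) P ∧
    φ ξ = ∫ ω, Z ω * (ξ : Ω →ₘ[P] ℝ) ω ∂P

/-- `Z`, as an element of `L¹(P)`, belongs to the order continuous dual of `L`. -/
def IsDualDensity (L : Submodule ℝ (Ω →ₘ[P] ℝ)) (Z : Ω → ℝ) : Prop :=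
  ∃ φ ∈ orderContinuousDual L, Represents L Z φ

end Spaces

/-! ### Conditional maps and the dual functional -/

section Maps

variable {Ω : Type u} (𝒢 : MeasurableSpace Ω) [mΩ : MeasurableSpace Ω] {P : Measure Ω}
  {LF LG : Submodule ℝ (Ω →ₘ[P] ℝ)}

/-- (QCO): `π (Λ X + (1 - Λ) Y) ≤ π X ∨ π Y` for `𝒢`-measurable `0 ≤ Λ ≤ 1`, whenever the
combination `W = Λ X + (1 - Λ) Y` belongs to the domain of `π`. -/
def IsCondQuasiconvex (π : LF → LG) : Prop :=
  ∀ (X Y W : LF) (Λ : Ω →ₘ[P] ℝ), AEStronglyMeasurable[𝒢] Λ P → 0 ≤ Λ → Λ ≤ 1 →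
    (W : Ω →ₘ[P] ℝ) = Λ * X + (1 - Λ) * Y →
      (π W : Ω →ₘ[P] ℝ) ≤ (π X : Ω →ₘ[P] ℝ) ⊔ (π Y : Ω →ₘ[P] ℝ)

/-- (REG): `π (X 1_A + Y 1_{Aᶜ}) = π X 1_A + π Y 1_{Aᶜ}` for `A` in `𝒢`. -/
def IsRegular (h𝒢 : 𝒢 ≤ mΩ) (π : LF → LG) : Prop :=
  ∀ (X Y W : LF) (A : Set Ω) (hA : MeasurableSet[𝒢] A),
    (W : Ω →ₘ[P] ℝ) = X * ind P A (h𝒢 A hA) + Y * ind P Aᶜ (h𝒢 A hA).compl →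
      (π W : Ω →ₘ[P] ℝ) = π X * ind P A (h𝒢 A hA) + π Y * ind P Aᶜ (h𝒢 A hA).compl

/-- (LSC): the sets `{π ≤ Y}`, `Y ∈ LG`, are closed in the weak topology of `LF`. -/
def IsWeakLSC (π : LF → LG) : Prop :=
  ∀ Y : LG, IsClosed[weakTopology LF] {X : LF | π X ≤ Y}

/-- `K(X, Q) = ess inf {π ξ | ξ ∈ LF, E_Q[ξ | 𝒢] ≥ E_Q[X | 𝒢] Q-a.s.}`. -/
noncomputable def K [IsFiniteMeasure P] (π : LF → LG) (X : LF) (Q : Measure Ω) : Ω →ₘ[P] EReal :=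
  essinf {k | ∃ ξ : LF, Q[((X : Ω →ₘ[P] ℝ) : Ω → ℝ)|𝒢] ≤ᵐ[Q] Q[((ξ : Ω →ₘ[P] ℝ) : Ω → ℝ)|𝒢] ∧
    k = toEReal (π ξ : Ω →ₘ[P] ℝ)}

/-- The probabilities `Q ≪ P` whose density `dQ/dP` lies in the order continuous dual of `LF`
and that coincide with `P` on `𝒢`. -/
def dualProbabilities (LF : Submodule ℝ (Ω →ₘ[P] ℝ)) : Set (Measure Ω) :=
  {Q | IsProbabilityMeasure Q ∧ Q ≪ P ∧ IsDualDensity LF (fun ω => (Q.rnDeriv P ω).toReal) ∧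
    ∀ A, MeasurableSet[𝒢] A → Q A = P A}

end Maps

end QuasiconvexDual

namespace QuasiconvexDual

universe u

/-! ### Exhaustion by a family of sets that is stable under unions -/

/-! Since `X` competes in the infimum defining `K(X, Q)`, only `π X ≤ ess sup K(X, Q)` needs work.
It suffices to prove `Y ≤ ess sup K(X, Q)` whenever `π η ≤ Y < π X`, because suitable `Y` increase
to `π X`. Fix `Y`. The set `C = {π ≤ Y}` is convex, weakly closed, stable under gluing along `𝒢`,
and contains `η`. Given a non-null `B` in `𝒢`, the element `x` equal to `X` on `B` and to `η` off
`B` lies outside `C`, so Hahn-Banach separates it from `C` by an order continuous functional,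
positive by monotonicity, hence given by a density `Z ≥ 0`. This scalar separation becomes
conditional (`exists_condSeparated`): let `U` be the largest `𝒢`-set covered by sets on which some
`ξ ∈ C` satisfies `E[Z x | 𝒢] ≤ E[Z ξ | 𝒢]`. Gluing shows that `U` is not of full measure. Up to
null sets, `Uᶜ` lies in `B ∩ {E[Z | 𝒢] > 0}`. On a part `D` of `Uᶜ`, dividing `Z` by `E[Z | 𝒢]`
produces a dual probability `Q` (`exists_dualProbability_isDominatedOn`). If `E_Q[ξ | 𝒢] ≥ E_Q[X |
𝒢]`, then `π ξ < Y` can hold only on a null part of `D`; so `K(X, Q) ≥ Y` on `D`. As `B` was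
arbitrary, these pieces suffice (`measure_eq_zero_of_forall_exists_subset`). -/

theorem exists_monotone_seq_exhausting {Ω : Type*} [MeasurableSpace Ω] (P : Measure Ω)
    [IsFiniteMeasure P] {𝒜 : Set (Set Ω)} (hne : 𝒜.Nonempty)
    (hmeas : ∀ A ∈ 𝒜, MeasurableSet A) (hunion : ∀ A ∈ 𝒜, ∀ B ∈ 𝒜, A ∪ B ∈ 𝒜) :
    ∃ A : ℕ → Set Ω, Monotone A ∧ (∀ n, A n ∈ 𝒜) ∧ ∀ E ∈ 𝒜, P (E \ ⋃ n, A n) = 0 := by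
  -- The partial unions of a maximising sequence exhaust `𝒜`: adding `E` to their union `U` cannot
  -- raise its measure above the supremum.
  obtain ⟨v, -, hv, hvA⟩ := exists_seq_tendsto_sSup (hne.image P) (OrderTop.bddAbove _)
  choose S hS hSv using hvA
  have hacc : ∀ n, Set.accumulate S n ∈ 𝒜 := by
    intro n
    induction n with
    | zero => simpa [Set.accumulate_zero_nat] using hS 0
    | succ n ih =>
      rw [Set.accumulate_succ]
      exact hunion _ ih _ (hS _)
  refine ⟨Set.accumulate S, Set.monotone_accumulate, hacc, fun E hE => ?_⟩
  set U := ⋃ n, Set.accumulate S n with hU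
  have hUm : MeasurableSet U := MeasurableSet.iUnion fun n => hmeas _ (hacc n)
  have hlow : sSup (P '' 𝒜) ≤ P U := by
    refine le_of_tendsto' hv fun n => ?_
    rw [← hSv]
    exact measure_mono (Set.subset_accumulate.trans (Set.subset_iUnion _ n))
  have hmono : Monotone fun n => E ∪ Set.accumulate S n := fun m n h =>
    Set.union_subset_union_right _ (Set.monotone_accumulate h)
  have hup : P (E ∪ U) ≤ P U := by
    rw [hU, Set.union_iUnion, hmono.measure_iUnion, ← hU]
    exact (iSup_le fun n => le_sSup (Set.mem_image_of_mem P (hunion _ hE _ (hacc n)))).trans hlow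
  rw [← Set.union_sdiff_right, measure_sdiff Set.subset_union_right hUm.nullMeasurableSet (by simp)]
  exact tsub_eq_zero_of_le hup

section Functionals

variable {Ω : Type u} [mΩ : MeasurableSpace Ω] {P : Measure Ω} {L : Submodule ℝ (Ω →ₘ[P] ℝ)}

/-! ### Separation by order continuous functionals -/

/-- Hahn-Banach yields a weakly continuous functional. Order null nets are weakly null by the very
definition of the dual, so that functional is order continuous. -/
theorem exists_orderContinuous_separating {C : Set L} (hconv : Convex ℝ C)
    (hclosed : IsClosed[weakTopology L] C) {x : L} (hx : x ∉ C) :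
    ∃ φ ∈ orderContinuousDual L, ∃ u : ℝ, (∀ a ∈ C, φ a < u) ∧ u < φ x := by
  let T : L →ₗ[ℝ] orderContinuousDual L → ℝ := LinearMap.pi fun φ => φ.1
  let : TopologicalSpace L := weakTopology L
  have : IsTopologicalAddGroup L := topologicalAddGroup_induced T
  have : ContinuousSMul ℝ L := continuousSMul_induced T
  have : LocallyConvexSpace ℝ L := LocallyConvexSpace.induced T
  obtain ⟨f, u, hf, hu⟩ := geometric_hahn_banach_closed_point hconv hclosed hx
  refine ⟨(f : L →ₗ[ℝ] ℝ), ?_, u, hf, hu⟩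
  intro ι _ _ _ y hy
  have h0 : Tendsto y atTop (𝓝 0) := by
    rw [nhds_induced, tendsto_comap_iff, tendsto_pi_nhds]
    intro φ
    simpa using φ.2 ι y hy
  have := (f.continuous.tendsto 0).comp h0
  rw [map_zero] at this
  exact this

/-! ### Densities of order continuous functionals -/

theorem Represents.congr {Z Z' : Ω → ℝ} {φ : L →ₗ[ℝ] ℝ} (h : Represents L Z φ)
    (hZ : Z =ᵐ[P] Z') : Represents L Z' φ := by
  refine ⟨h.1.congr hZ, fun ξ => ?_⟩
  have hae : (fun ω => Z ω * (ξ : Ω →ₘ[P] ℝ) ω) =ᵐ[P] fun ω => Z' ω * (ξ : Ω →ₘ[P] ℝ) ω := by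
    filter_upwards [hZ] with ω hω
    rw [hω]
  exact ⟨(h.2 ξ).1.congr hae, (h.2 ξ).2.trans (integral_congr_ae hae)⟩

theorem IsDualDensity.congr {Z Z' : Ω → ℝ} (h : IsDualDensity L Z) (hZ : Z =ᵐ[P] Z') :
    IsDualDensity L Z' := by
  obtain ⟨φ, hφ, hr⟩ := h
  exact ⟨φ, hφ, hr.congr hZ⟩

theorem IsDualDensity.add {Z Z' : Ω → ℝ} (h : IsDualDensity L Z) (h' : IsDualDensity L Z') :
    IsDualDensity L (fun ω => Z ω + Z' ω) := by
  obtain ⟨φ, hφ, hr⟩ := h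
  obtain ⟨φ', hφ', hr'⟩ := h'
  refine ⟨φ + φ', add_mem hφ hφ', hr.1.add hr'.1, fun ξ => ?_⟩
  simp only [add_mul]
  refine ⟨(hr.2 ξ).1.add (hr'.2 ξ).1, ?_⟩
  rw [integral_add (hr.2 ξ).1 (hr'.2 ξ).1, LinearMap.add_apply, (hr.2 ξ).2, (hr'.2 ξ).2]

/-- The dual densities are stable under bounded multipliers. -/
theorem IsDualDensity.bounded_mul {Z g : Ω → ℝ} (h : IsDualDensity L Z) (hZ : ∀ᵐ ω ∂P, 0 ≤ Z ω)
    (hg : Measurable g) {c : ℝ} (hgc : ∀ ω, |g ω| ≤ c) :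
    IsDualDensity L (fun ω => g ω * Z ω) := by
  obtain ⟨φ, hφ, hr⟩ := h
  have hint : ∀ ξ : L, Integrable (fun ω => g ω * Z ω * (ξ : Ω →ₘ[P] ℝ) ω) P := fun ξ => by
    simp only [mul_assoc]
    exact (hr.2 ξ).1.bdd_mul hg.aestronglyMeasurable (.of_forall fun ω => by simpa using hgc ω)
  let ψ : L →ₗ[ℝ] ℝ :=
    { toFun := fun ξ => ∫ ω, g ω * Z ω * (ξ : Ω →ₘ[P] ℝ) ω ∂P
      map_add' := fun ξ ζ => by
        rw [← integral_add (hint ξ) (hint ζ)]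
        refine integral_congr_ae ?_
        filter_upwards [AEEqFun.coeFn_add (ξ : Ω →ₘ[P] ℝ) (ζ : Ω →ₘ[P] ℝ)] with ω hω
        rw [Submodule.coe_add, hω, Pi.add_apply, mul_add]
      map_smul' := fun a ξ => by
        rw [RingHom.id_apply, smul_eq_mul, ← integral_const_mul]
        refine integral_congr_ae ?_
        filter_upwards [AEEqFun.coeFn_smul a (ξ : Ω →ₘ[P] ℝ)] with ω hω
        rw [Submodule.coe_smul, hω, Pi.smul_apply, smul_eq_mul]
        ring }
  refine ⟨ψ, ?_, hr.1.bdd_mul hg.aestronglyMeasurable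
    (.of_forall fun ω => by simpa using hgc ω), fun ξ => ⟨hint ξ, rfl⟩⟩
  rintro ι _ _ _ x ⟨y, hy, hy0, hxy⟩
  have hypos : ∀ i, 0 ≤ (y i : Ω →ₘ[P] ℝ) := fun i => hy0.1 ⟨i, rfl⟩
  have habs : ∀ i, |(y i : Ω →ₘ[P] ℝ)| ≤ (y i : Ω →ₘ[P] ℝ) := fun i => by
    rw [← AEEqFun.coeFn_le]
    filter_upwards [AEEqFun.coeFn_abs (y i : Ω →ₘ[P] ℝ), AEEqFun.coeFn_le.2 (hypos i),
      AEEqFun.coeFn_zero (α := Ω) (β := ℝ) (μ := P)] with ω h1 h2 h3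
    rw [h3] at h2
    rw [h1, abs_of_nonneg h2]
  -- The dominating net `y` itself order converges to `0`, and `|ψ (x i)| ≤ c φ (y i)` because `Z ≥
  -- 0`.
  have hlim : Tendsto (fun i => c * φ (y i)) atTop (𝓝 0) := by
    simpa using (hφ ι y ⟨y, hy, hy0, habs⟩).const_mul c
  refine squeeze_zero_norm (fun i => ?_) hlim
  rw [(hr.2 (y i)).2, ← integral_const_mul]
  refine norm_integral_le_of_norm_le ((hr.2 (y i)).1.const_mul c) ?_
  filter_upwards [hZ, AEEqFun.coeFn_le.2 (hxy i), AEEqFun.coeFn_abs (x i : Ω →ₘ[P] ℝ)]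
    with ω h1 h2 h3
  rw [h3] at h2
  rw [Real.norm_eq_abs, abs_mul, abs_mul, abs_of_nonneg h1, mul_assoc]
  exact mul_le_mul (hgc ω) (mul_le_mul_of_nonneg_left h2 h1) (by positivity)
    ((abs_nonneg _).trans (hgc ω))

end Functionals

/-! ### Gluing and positive densities -/

section Gluing

variable {Ω : Type u} {𝒢 : MeasurableSpace Ω} [mΩ : MeasurableSpace Ω] {P : Measure Ω} {LF LG : Submodule ℝ (Ω →ₘ[P] ℝ)}

theorem coeFn_mul_ind_add (f g : Ω →ₘ[P] ℝ) {A : Set Ω} (hA : MeasurableSet A)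
    (hAc : MeasurableSet Aᶜ) :
    ∀ᵐ ω ∂P, (ω ∈ A → (f * ind P A hA + g * ind P Aᶜ hAc : Ω →ₘ[P] ℝ) ω = f ω) ∧
      (ω ∉ A → (f * ind P A hA + g * ind P Aᶜ hAc : Ω →ₘ[P] ℝ) ω = g ω) := by
  filter_upwards [AEEqFun.coeFn_add (f * ind P A hA) (g * ind P Aᶜ hAc),
    AEEqFun.coeFn_mul f (ind P A hA), AEEqFun.coeFn_mul g (ind P Aᶜ hAc),
    AEEqFun.coeFn_mk (μ := P) (A.indicator fun _ => (1 : ℝ))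
      (measurable_const.indicator hA).aestronglyMeasurable,
    AEEqFun.coeFn_mk (μ := P) (Aᶜ.indicator fun _ => (1 : ℝ))
      (measurable_const.indicator hAc).aestronglyMeasurable] with ω h1 h2 h3 h4 h5
  rw [h1, Pi.add_apply, h2, h3, Pi.mul_apply, Pi.mul_apply, ind, ind, h4, h5]
  constructor <;> intro h <;> simp [h]

/-- Two elements of `LF` can be glued along a measurable set. -/
theorem IsRandomLattice.exists_glue (hLF : IsRandomLattice mΩ le_rfl LF) (ξ ζ : LF) {A : Set Ω}
    (hA : MeasurableSet A) :
    ∃ W : LF, (W : Ω →ₘ[P] ℝ) = ξ * ind P A hA + ζ * ind P Aᶜ hA.compl ∧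
      ∀ᵐ ω ∂P, (ω ∈ A → (W : Ω →ₘ[P] ℝ) ω = (ξ : Ω →ₘ[P] ℝ) ω) ∧
        (ω ∉ A → (W : Ω →ₘ[P] ℝ) ω = (ζ : Ω →ₘ[P] ℝ) ω) :=
  ⟨⟨_, LF.add_mem (hLF.mul_ind_mem _ ξ.2 A hA) (hLF.mul_ind_mem _ ζ.2 Aᶜ hA.compl)⟩, rfl,
    coeFn_mul_ind_add _ _ _ _⟩

/-- Gluing along a set of `𝒢` commutes with a regular map. -/
theorem IsRegular.exists_glue {h𝒢 : 𝒢 ≤ mΩ} {π : LF → LG}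
    (hREG : IsRegular 𝒢 h𝒢 π) (hLF : IsRandomLattice mΩ le_rfl LF) (ξ ζ : LF) {A : Set Ω}
    (hA : MeasurableSet[𝒢] A) :
    ∃ W : LF, (∀ᵐ ω ∂P, (ω ∈ A → (W : Ω →ₘ[P] ℝ) ω = (ξ : Ω →ₘ[P] ℝ) ω) ∧
        (ω ∉ A → (W : Ω →ₘ[P] ℝ) ω = (ζ : Ω →ₘ[P] ℝ) ω)) ∧
      ∀ᵐ ω ∂P, (ω ∈ A → (π W : Ω →ₘ[P] ℝ) ω = (π ξ : Ω →ₘ[P] ℝ) ω) ∧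
        (ω ∉ A → (π W : Ω →ₘ[P] ℝ) ω = (π ζ : Ω →ₘ[P] ℝ) ω) := by
  obtain ⟨W, hW, hWae⟩ := hLF.exists_glue ξ ζ (h𝒢 A hA)
  refine ⟨W, hWae, ?_⟩
  rw [hREG ξ ζ W A hA hW]
  exact coeFn_mul_ind_add _ _ _ _

/-- A positive functional with a density has a nonnegative measurable density. -/
theorem Represents.exists_nonneg (hLF : IsRandomLattice mΩ le_rfl LF) {Z : Ω → ℝ}
    {φ : LF →ₗ[ℝ] ℝ} (h : Represents LF Z φ) (hφ : ∀ W : LF, 0 ≤ (W : Ω →ₘ[P] ℝ) → 0 ≤ φ W) :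
    ∃ Z' : Ω → ℝ, Measurable Z' ∧ (∀ ω, 0 ≤ Z' ω) ∧ Represents LF Z' φ := by
  wlog hZm : Measurable Z generalizing Z
  · exact this (h.congr h.1.1.ae_eq_mk) h.1.1.stronglyMeasurable_mk.measurable
  -- `Z` may be negative where all elements of `LF` vanish, so it is replaced by its positive part.
  -- Testing positivity on `|ξ|` restricted to `{Z < 0}` shows that the products with `ξ` do not
  -- change.
  have key : ∀ ξ : LF, (fun ω => Z ω * (ξ : Ω →ₘ[P] ℝ) ω) =ᵐ[P]
      fun ω => max (Z ω) 0 * (ξ : Ω →ₘ[P] ℝ) ω := by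
    intro ξ
    let ζ : LF := ⟨|(ξ : Ω →ₘ[P] ℝ)|, hLF.sup_mem _ ξ.2 _ (LF.neg_mem ξ.2)⟩
    have hA : MeasurableSet {ω | Z ω < 0} := measurableSet_lt hZm measurable_const
    obtain ⟨W, -, hW⟩ := hLF.exists_glue ζ 0 hA
    have hW' : ∀ᵐ ω ∂P, (Z ω < 0 → (W : Ω →ₘ[P] ℝ) ω = |(ξ : Ω →ₘ[P] ℝ) ω|) ∧
        (¬ Z ω < 0 → (W : Ω →ₘ[P] ℝ) ω = 0) := by
      filter_upwards [hW, AEEqFun.coeFn_abs (ξ : Ω →ₘ[P] ℝ),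
        AEEqFun.coeFn_zero (α := Ω) (β := ℝ) (μ := P)] with ω h1 h2 h3
      refine ⟨fun hz => (h1.1 hz).trans h2, fun hz => (h1.2 hz).trans ?_⟩
      rw [Submodule.coe_zero, h3, Pi.zero_apply]
    have hWpos : 0 ≤ (W : Ω →ₘ[P] ℝ) := by
      rw [← AEEqFun.coeFn_le]
      filter_upwards [hW', AEEqFun.coeFn_zero (α := Ω) (β := ℝ) (μ := P)] with ω h1 h2
      rw [h2, Pi.zero_apply]
      by_cases hz : Z ω < 0
      · rw [h1.1 hz]; exact abs_nonneg _
      · rw [h1.2 hz]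
    have h0 := hφ W hWpos
    rw [(h.2 W).2] at h0
    have hneg : ∀ᵐ ω ∂P, 0 ≤ -(Z ω * (W : Ω →ₘ[P] ℝ) ω) := by
      filter_upwards [hW'] with ω h1
      by_cases hz : Z ω < 0
      · rw [h1.1 hz, ← neg_mul]
        exact mul_nonneg (by linarith) (abs_nonneg _)
      · rw [h1.2 hz]; simp
    have hz := (integral_eq_zero_iff_of_nonneg_ae hneg (h.2 W).1.neg).1
      (le_antisymm (by rw [integral_neg]; linarith) (integral_nonneg_of_ae hneg))
    filter_upwards [hz, hW'] with ω h1 h2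
    by_cases hz : Z ω < 0
    · rw [h2.1 hz, Pi.zero_apply, neg_eq_zero, mul_eq_zero, abs_eq_zero] at h1
      rw [h1.resolve_left hz.ne]
      simp
    · rw [max_eq_left (not_lt.1 hz)]
  exact ⟨fun ω => max (Z ω) 0, hZm.max measurable_const, fun ω => le_max_right _ _,
    h.1.pos_part, fun ξ => ⟨(h.2 ξ).1.congr (key ξ), (h.2 ξ).2.trans (integral_congr_ae (key ξ))⟩⟩

end Gluing

/-! ### From scalar to conditional separation -/

section CondSeparation

variable {Ω : Type u} (𝒢 : MeasurableSpace Ω) [mΩ : MeasurableSpace Ω] {P : Measure Ω}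
  {LF : Submodule ℝ (Ω →ₘ[P] ℝ)}

/-- `C` is stable under gluing along sets of `𝒢`. -/
def IsGlueStable (C : Set LF) : Prop :=
  ∀ ξ ∈ C, ∀ ζ ∈ C, ∀ A, MeasurableSet[𝒢] A → ∃ W ∈ C,
    ∀ᵐ ω ∂P, (ω ∈ A → (W : Ω →ₘ[P] ℝ) ω = (ξ : Ω →ₘ[P] ℝ) ω) ∧
      (ω ∉ A → (W : Ω →ₘ[P] ℝ) ω = (ζ : Ω →ₘ[P] ℝ) ω)

/-- On every part of `A` that belongs to `𝒢`, `Z` gives `x` at most the value of `ξ`; that is,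
`E[Z x | 𝒢] ≤ E[Z ξ | 𝒢]` on `A`. -/
def IsDominatedOn (Z : Ω → ℝ) (x ξ : LF) (A : Set Ω) : Prop :=
  ∀ E ⊆ A, MeasurableSet[𝒢] E →
    ∫ ω in E, Z ω * (x : Ω →ₘ[P] ℝ) ω ∂P ≤ ∫ ω in E, Z ω * (ξ : Ω →ₘ[P] ℝ) ω ∂P

variable {𝒢}

theorem setIntegral_mul_congr (h𝒢 : 𝒢 ≤ mΩ) (Z : Ω → ℝ) {f g : Ω → ℝ} {E : Set Ω}
    (hE : MeasurableSet[𝒢] E) (h : ∀ᵐ ω ∂P, ω ∈ E → f ω = g ω) :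
    ∫ ω in E, Z ω * f ω ∂P = ∫ ω in E, Z ω * g ω ∂P := by
  refine setIntegral_congr_ae (h𝒢 E hE) ?_
  filter_upwards [h] with ω hω hωE
  rw [hω hωE]

/-- A functional that strictly separates `x` from a glue stable set `C` separates them
conditionally on a set `Uᶜ` of positive probability. -/
theorem exists_condSeparated [IsFiniteMeasure P] (h𝒢 : 𝒢 ≤ mΩ) {Z : Ω → ℝ} {φ : LF →ₗ[ℝ] ℝ}
    (hZ : Represents LF Z φ) {C : Set LF} (hC : IsGlueStable 𝒢 C) (hne : C.Nonempty)
    {x : LF} {u : ℝ} (hCu : ∀ ξ ∈ C, φ ξ < u) (hxu : u < φ x) :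
    ∃ U, MeasurableSet[𝒢] U ∧ P Uᶜ ≠ 0 ∧
      ∀ A, MeasurableSet[𝒢] A → ∀ ξ ∈ C, IsDominatedOn 𝒢 Z x ξ A → P (A \ U) = 0 := by
  obtain ⟨η, hη⟩ := hne
  let 𝒜 : Set (Set Ω) := {A | MeasurableSet[𝒢] A ∧ ∃ ξ ∈ C, IsDominatedOn 𝒢 Z x ξ A}
  have hint : ∀ ξ : LF, Integrable (fun ω => Z ω * (ξ : Ω →ₘ[P] ℝ) ω) P := fun ξ => (hZ.2 ξ).1
  have hempty : ∅ ∈ 𝒜 := ⟨@MeasurableSet.empty _ 𝒢, η, hη, fun E hE _ => by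
    simp [Set.subset_empty_iff.1 hE]⟩
  have hunion : ∀ A ∈ 𝒜, ∀ B ∈ 𝒜, A ∪ B ∈ 𝒜 := by
    rintro A ⟨hA, ξ, hξ, hAξ⟩ B ⟨hB, ζ, hζ, hBζ⟩
    obtain ⟨W, hW, hWae⟩ := hC ξ hξ ζ hζ A hA
    refine ⟨hA.union hB, W, hW, fun E hE hEm => ?_⟩
    have h1 : MeasurableSet[𝒢] (E ∩ A) := hEm.inter hA
    have h2 : MeasurableSet[𝒢] (E \ A) := hEm.diff hA
    rw [← integral_inter_add_sdiff (h𝒢 A hA) (hint x).integrableOn,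
      ← integral_inter_add_sdiff (h𝒢 A hA) (hint W).integrableOn,
      setIntegral_mul_congr h𝒢 Z h1 (hWae.mono fun ω hω hωE => hω.1 hωE.2),
      setIntegral_mul_congr h𝒢 Z h2 (hWae.mono fun ω hω hωE => hω.2 hωE.2)]
    exact add_le_add (hAξ _ Set.inter_subset_right h1)
      (hBζ _ (fun ω hω => (hE hω.1).resolve_left hω.2) h2)
  obtain ⟨A, hAmono, hA, hAex⟩ := exists_monotone_seq_exhausting P ⟨_, hempty⟩
    (fun A hA => h𝒢 A hA.1) hunion
  refine ⟨⋃ n, A n, MeasurableSet.iUnion fun n => (hA n).1, fun hU => ?_,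
    fun B hB ξ hξ hd => hAex B ⟨hB, ξ, hξ, hd⟩⟩
  set U := ⋃ n, A n with hUdef
  let F : Ω → ℝ := fun ω => Z ω * (x : Ω →ₘ[P] ℝ) ω - Z ω * (η : Ω →ₘ[P] ℝ) ω
  have hF : Integrable F P := (hint x).sub (hint η)
  have hlim : Tendsto (fun n => ∫ ω in A n, F ω ∂P) atTop (𝓝 (∫ ω, F ω ∂P)) := by
    have h := tendsto_setIntegral_of_monotone (fun n => h𝒢 _ (hA n).1) hAmono
      (hF.integrableOn (s := ⋃ n, A n))
    rwa [← hUdef, Measure.restrict_eq_self_of_ae_mem (s := U) (mem_ae_iff.2 hU)] at h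
  -- Gluing the dominating `ξ` on `A n` with `η` elsewhere gives an element of `C`, whose `φ`-value
  -- is below `u`. If `Uᶜ` were null, the limit would read `φ x ≤ u`.
  have hle : ∀ n, ∫ ω in A n, F ω ∂P ≤ u - φ η := by
    intro n
    obtain ⟨hAn, ξ, hξ, hd⟩ := hA n
    obtain ⟨W, hW, hWae⟩ := hC ξ hξ η hη _ hAn
    have h1 := hCu W hW
    rw [(hZ.2 W).2, ← integral_add_compl (h𝒢 _ hAn) (hint W),
      setIntegral_mul_congr h𝒢 Z hAn (hWae.mono fun ω hω hωE => hω.1 hωE),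
      setIntegral_mul_congr h𝒢 Z hAn.compl (hWae.mono fun ω hω hωE => hω.2 hωE)] at h1
    have h2 := hd _ subset_rfl hAn
    rw [(hZ.2 η).2, ← integral_add_compl (h𝒢 _ hAn) (hint η),
      integral_sub (hint x).integrableOn (hint η).integrableOn]
    linarith
  have := le_of_tendsto' hlim hle
  rw [integral_sub (hint x) (hint η), ← (hZ.2 x).2, ← (hZ.2 η).2] at this
  linarith

/-- A nonnegative dual density whose conditional expectation is bounded below on `D` can be
normalised on `D` and completed to the density of a dual probability. -/
theorem exists_dualProbability_isDominatedOn [IsProbabilityMeasure P] (h𝒢 : 𝒢 ≤ mΩ)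
    (hne : (dualProbabilities 𝒢 LF).Nonempty) {Z : Ω → ℝ} (hZm : Measurable Z)
    (hZ0 : ∀ ω, 0 ≤ Z ω) (hZ : IsDualDensity LF Z) {D : Set Ω} (hD : MeasurableSet[𝒢] D)
    {c : ℝ} (hc : 0 < c) (hDc : ∀ ω ∈ D, c ≤ (P[Z|𝒢]) ω) :
    ∃ Q ∈ dualProbabilities 𝒢 LF, ∀ x ξ : LF,
      Q[((x : Ω →ₘ[P] ℝ) : Ω → ℝ)|𝒢] ≤ᵐ[Q] Q[((ξ : Ω →ₘ[P] ℝ) : Ω → ℝ)|𝒢] →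
        IsDominatedOn 𝒢 Z x ξ D := by
  obtain ⟨Q₀, hQ₀p, hQ₀P, hQ₀d, hQ₀𝒢⟩ := hne
  set q : Ω → ℝ := P[Z|𝒢] with hq
  have hqm : Measurable[𝒢] q := stronglyMeasurable_condExp.measurable
  have hZint : Integrable Z P := by
    obtain ⟨φ, -, hr⟩ := hZ
    exact hr.1
  let Z₀ : Ω → ℝ := fun ω => (Q₀.rnDeriv P ω).toReal
  have hZ₀m : Measurable Z₀ := (Measure.measurable_rnDeriv _ _).ennreal_toReal
  let g : Ω → ℝ := D.indicator fun ω => (q ω)⁻¹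
  let e : Ω → ℝ := Dᶜ.indicator fun _ => 1
  have hgm𝒢 : Measurable[𝒢] g := hqm.inv.indicator hD
  have hgm : Measurable g := hgm𝒢.mono h𝒢 le_rfl
  have hem : Measurable e := measurable_const.indicator (h𝒢 D hD).compl
  have hg0 : ∀ ω, 0 ≤ g ω := fun ω =>
    Set.indicator_nonneg (fun ω hω => inv_nonneg.2 (hc.le.trans (hDc ω hω))) ω
  have hgc : ∀ ω, |g ω| ≤ c⁻¹ := fun ω => by
    rw [abs_of_nonneg (hg0 ω)]
    by_cases hω : ω ∈ D
    · simp only [g, Set.indicator_of_mem hω]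
      exact inv_anti₀ hc (hDc ω hω)
    · simp only [g, Set.indicator_of_notMem hω]
      positivity
  have he0 : ∀ ω, 0 ≤ e ω := fun ω => Set.indicator_nonneg (fun _ _ => zero_le_one) ω
  have he1 : ∀ ω, |e ω| ≤ 1 := fun ω => by
    rw [abs_of_nonneg (he0 ω)]
    exact Set.indicator_le_self' (fun _ _ => zero_le_one) ω
  -- `Z / E[Z | 𝒢]` on `D` and the density of `Q₀` off `D`: each part has conditional expectation
  -- `1` where it is used, and the lower bound `c` keeps the multiplier bounded.
  let Z' : Ω → ℝ := fun ω => g ω * Z ω + e ω * Z₀ ω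
  have hZ'm : Measurable Z' := (hgm.mul hZm).add (hem.mul hZ₀m)
  have hZ'0 : ∀ ω, 0 ≤ Z' ω := fun ω =>
    add_nonneg (mul_nonneg (hg0 ω) (hZ0 ω)) (mul_nonneg (he0 ω) ENNReal.toReal_nonneg)
  have hgZd : IsDualDensity LF fun ω => g ω * Z ω := hZ.bounded_mul (.of_forall hZ0) hgm hgc
  have heZd : IsDualDensity LF fun ω => e ω * Z₀ ω :=
    hQ₀d.bounded_mul (.of_forall fun ω => ENNReal.toReal_nonneg) hem he1
  have hZ'd : IsDualDensity LF Z' := hgZd.add heZd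
  have hgZi : Integrable (fun ω => g ω * Z ω) P := by
    obtain ⟨φ, -, hr⟩ := hgZd
    exact hr.1
  have heZi : Integrable (fun ω => e ω * Z₀ ω) P := by
    obtain ⟨φ, -, hr⟩ := heZd
    exact hr.1
  let f : Ω → ENNReal := fun ω => ENNReal.ofReal (Z' ω)
  have hfm : Measurable f := hZ'm.ennreal_ofReal
  have hftop : ∀ ω, f ω < ⊤ := fun ω => ENNReal.ofReal_lt_top
  have hfreal : ∀ ω, (f ω).toReal = Z' ω := fun ω => ENNReal.toReal_ofReal (hZ'0 ω)
  let Q : Measure Ω := P.withDensity f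
  have hQ𝒢 : ∀ A, MeasurableSet[𝒢] A → Q A = P A := by
    intro A hA
    have h1 : ∫ ω in A, g ω * Z ω ∂P = P.real (A ∩ D) := by
      have hpull : P[g * Z|𝒢] =ᵐ[P] g * q :=
        condExp_mul_of_stronglyMeasurable_left hgm𝒢.stronglyMeasurable hgZi hZint
      calc ∫ ω in A, g ω * Z ω ∂P = ∫ ω in A, (P[g * Z|𝒢]) ω ∂P :=
            (setIntegral_condExp h𝒢 hgZi hA).symm
        _ = ∫ ω in A, D.indicator (fun _ => (1 : ℝ)) ω ∂P := by
            refine setIntegral_congr_ae (h𝒢 A hA) ?_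
            filter_upwards [hpull] with ω hω _
            rw [hω, Pi.mul_apply]
            by_cases hωD : ω ∈ D
            · simp only [g, Set.indicator_of_mem hωD]
              exact inv_mul_cancel₀ (hc.trans_le (hDc ω hωD)).ne'
            · simp only [g, Set.indicator_of_notMem hωD, zero_mul]
        _ = P.real (A ∩ D) := by
            rw [setIntegral_indicator (h𝒢 D hD)]
            simp
    have h2 : ∫ ω in A, e ω * Z₀ ω ∂P = P.real (A ∩ Dᶜ) := by
      have : (fun ω => e ω * Z₀ ω) = Dᶜ.indicator Z₀ := by
        ext ω
        by_cases hωD : ω ∈ D <;> simp [e, hωD]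
      rw [this, setIntegral_indicator (h𝒢 D hD).compl,
        Measure.setIntegral_toReal_rnDeriv hQ₀P, measureReal_def,
        hQ₀𝒢 _ (hA.inter hD.compl), measureReal_def]
    have h3 : ∫ ω in A, Z' ω ∂P = P.real A := by
      rw [integral_add hgZi.integrableOn heZi.integrableOn, h1, h2, ← Set.sdiff_eq]
      exact measureReal_inter_add_sdiff (h𝒢 D hD)
    rw [withDensity_apply _ (h𝒢 A hA), ← ofReal_integral_eq_lintegral_ofReal
      (f := Z') (hgZi.add heZi).integrableOn (.of_forall hZ'0), h3, ofReal_measureReal]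
  have hQp : IsProbabilityMeasure Q := ⟨by rw [hQ𝒢 _ MeasurableSet.univ, measure_univ]⟩
  refine ⟨Q, ⟨hQp, withDensity_absolutelyContinuous _ _, hZ'd.congr ?_, hQ𝒢⟩, ?_⟩
  · filter_upwards [Measure.rnDeriv_withDensity P hfm] with ω hω
    rw [hω, hfreal]
  intro x ξ hxξ E hED hE
  -- The multiplier `m` undoes the normalisation, `m Z' = 1_D Z`. Being nonnegative and
  -- `𝒢`-measurable, it leaves `E_Q[· | 𝒢]` and preserves the inequality.
  let m : Ω → ℝ := D.indicator q
  have hmm : Measurable[𝒢] m := hqm.indicator hD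
  have hm0 : ∀ ω, 0 ≤ m ω := fun ω =>
    Set.indicator_nonneg (fun ω hω => hc.le.trans (hDc ω hω)) ω
  have hQi : ∀ ζ : LF, Integrable (ζ : Ω →ₘ[P] ℝ) Q := by
    intro ζ
    obtain ⟨φ, -, hr⟩ := hZ'd
    rw [integrable_withDensity_iff_integrable_smul' hfm (.of_forall hftop)]
    simpa only [hfreal, smul_eq_mul] using (hr.2 ζ).1
  have hmul : ∀ (ζ : LF) (ω : Ω), Z' ω * (m ω * (ζ : Ω →ₘ[P] ℝ) ω) =
      D.indicator (fun ω => Z ω * (ζ : Ω →ₘ[P] ℝ) ω) ω := by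
    intro ζ ω
    by_cases hω : ω ∈ D
    · have hqω : q ω ≠ 0 := (hc.trans_le (hDc ω hω)).ne'
      simp only [Z', g, e, m, Set.indicator_of_mem hω, Set.indicator_of_notMem
        (Set.notMem_compl_iff.2 hω)]
      field_simp
      ring
    · simp [m, hω]
  have hmi : ∀ ζ : LF, Integrable (m * ((ζ : Ω →ₘ[P] ℝ) : Ω → ℝ)) Q := by
    intro ζ
    obtain ⟨φ, -, hr⟩ := hZ
    rw [integrable_withDensity_iff_integrable_smul' hfm (.of_forall hftop)]
    simp only [hfreal, Pi.mul_apply, smul_eq_mul, hmul]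
    exact (hr.2 ζ).1.indicator (h𝒢 D hD)
  have hpull : ∀ ζ : LF, Q[m * ((ζ : Ω →ₘ[P] ℝ) : Ω → ℝ)|𝒢] =ᵐ[Q]
      m * Q[((ζ : Ω →ₘ[P] ℝ) : Ω → ℝ)|𝒢] := fun ζ =>
    condExp_mul_of_stronglyMeasurable_left hmm.stronglyMeasurable (hmi ζ) (hQi ζ)
  have hE' : ∀ ζ : LF, ∫ ω in E, Z ω * (ζ : Ω →ₘ[P] ℝ) ω ∂P =
      ∫ ω in E, (Q[m * ((ζ : Ω →ₘ[P] ℝ) : Ω → ℝ)|𝒢]) ω ∂Q := by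
    intro ζ
    rw [setIntegral_condExp h𝒢 (hmi ζ) hE,
      setIntegral_withDensity_eq_setIntegral_toReal_smul hfm (.of_forall hftop) _ (h𝒢 E hE)]
    simp only [hfreal, Pi.mul_apply, smul_eq_mul, hmul]
    rw [setIntegral_indicator (h𝒢 D hD), Set.inter_eq_left.2 hED]
  rw [hE', hE']
  refine setIntegral_mono_ae integrable_condExp.integrableOn integrable_condExp.integrableOn ?_
  filter_upwards [hpull x, hpull ξ, hxξ] with ω h1 h2 h3
  rw [h1, h2]
  exact mul_le_mul_of_nonneg_left h3 (hm0 ω)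

end CondSeparation

/-! ### Sublevel sets and local lower bounds for `K` -/

section Duality

variable {Ω : Type u} {𝒢 : MeasurableSpace Ω} [mΩ : MeasurableSpace Ω] {P : Measure Ω}
  {LF LG : Submodule ℝ (Ω →ₘ[P] ℝ)}

theorem IsCondQuasiconvex.convex_sublevel {π : LF → LG} (hQCO : IsCondQuasiconvex 𝒢 π) (Y : LG) :
    Convex ℝ {ξ : LF | π ξ ≤ Y} := by
  intro ξ hξ ζ hζ a b ha hb hab
  have hΛ : ∀ᵐ ω ∂P, (AEEqFun.const Ω a : Ω →ₘ[P] ℝ) ω = a := AEEqFun.coeFn_const Ω a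
  have h1 : ∀ᵐ ω ∂P, (1 : Ω →ₘ[P] ℝ) ω = 1 := AEEqFun.coeFn_one
  refine (hQCO ξ ζ (a • ξ + b • ζ) (AEEqFun.const Ω a)
    (aestronglyMeasurable_const.congr (EventuallyEq.symm hΛ)) ?_ ?_ ?_).trans (sup_le hξ hζ)
  · rw [← AEEqFun.coeFn_le]
    filter_upwards [hΛ, AEEqFun.coeFn_zero (α := Ω) (β := ℝ) (μ := P)] with ω h h0
    rw [h, h0]
    exact ha
  · rw [← AEEqFun.coeFn_le]
    filter_upwards [hΛ, h1] with ω h h0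
    rw [h, h0]
    linarith
  · refine AEEqFun.ext ?_
    rw [Submodule.coe_add, Submodule.coe_smul, Submodule.coe_smul]
    filter_upwards [hΛ, h1, AEEqFun.coeFn_add (a • (ξ : Ω →ₘ[P] ℝ)) (b • (ζ : Ω →ₘ[P] ℝ)),
      AEEqFun.coeFn_smul a (ξ : Ω →ₘ[P] ℝ), AEEqFun.coeFn_smul b (ζ : Ω →ₘ[P] ℝ),
      AEEqFun.coeFn_add ((AEEqFun.const Ω a : Ω →ₘ[P] ℝ) * (ξ : Ω →ₘ[P] ℝ))
        ((1 - AEEqFun.const Ω a) * (ζ : Ω →ₘ[P] ℝ)),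
      AEEqFun.coeFn_mul (AEEqFun.const Ω a : Ω →ₘ[P] ℝ) ξ,
      AEEqFun.coeFn_mul (1 - AEEqFun.const Ω a : Ω →ₘ[P] ℝ) ζ,
      AEEqFun.coeFn_sub (1 : Ω →ₘ[P] ℝ) (AEEqFun.const Ω a)]
      with ω e1 e2 e3 e4 e5 e6 e7 e8 e9
    rw [e3, e6]
    simp only [Pi.add_apply]
    rw [e4, e5, e7, e8]
    simp only [Pi.smul_apply, Pi.mul_apply, smul_eq_mul]
    rw [e9]
    simp only [Pi.sub_apply]
    rw [e1, e2, ← hab]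
    ring

theorem IsRegular.isGlueStable_sublevel {h𝒢 : 𝒢 ≤ mΩ} {π : LF → LG} (hREG : IsRegular 𝒢 h𝒢 π)
    (hLF : IsRandomLattice mΩ le_rfl LF) (Y : LG) : IsGlueStable 𝒢 {ξ : LF | π ξ ≤ Y} := by
  intro ξ hξ ζ hζ A hA
  obtain ⟨W, hW, hπ⟩ := hREG.exists_glue hLF ξ ζ hA
  refine ⟨W, ?_, hW⟩
  change (π W : Ω →ₘ[P] ℝ) ≤ Y
  rw [← AEEqFun.coeFn_le]
  filter_upwards [hπ, AEEqFun.coeFn_le.2 hξ, AEEqFun.coeFn_le.2 hζ] with ω h h1 h2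
  by_cases hω : ω ∈ A
  · rw [h.1 hω]; exact h1
  · rw [h.2 hω]; exact h2

/-- A functional that is bounded above on a sublevel set of a monotone map is positive. -/
theorem nonneg_of_lt_on_sublevel {π : LF → LG} (hMON : Monotone π) {Y : LG} {η : LF}
    (hη : π η ≤ Y) {φ : LF →ₗ[ℝ] ℝ} {u : ℝ} (hφ : ∀ ξ : LF, π ξ ≤ Y → φ ξ < u) (W : LF)
    (hW : 0 ≤ (W : Ω →ₘ[P] ℝ)) : 0 ≤ φ W := by
  by_contra! hneg
  have hηu := hφ η hη
  -- Chosen so that `φ (η - c • W) = u`, although `η - c • W ≤ η` remains in the sublevel set.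
  set c : ℝ := (u - φ η) / (-φ W) with hc
  have hc0 : 0 ≤ c := div_nonneg (by linarith) (by linarith)
  have hle : η - c • W ≤ η := by
    change ((η - c • W : LF) : Ω →ₘ[P] ℝ) ≤ η
    rw [Submodule.coe_sub, Submodule.coe_smul, ← AEEqFun.coeFn_le]
    filter_upwards [AEEqFun.coeFn_sub (η : Ω →ₘ[P] ℝ) (c • (W : Ω →ₘ[P] ℝ)),
      AEEqFun.coeFn_smul c (W : Ω →ₘ[P] ℝ), AEEqFun.coeFn_le.2 hW,
      AEEqFun.coeFn_zero (α := Ω) (β := ℝ) (μ := P)] with ω h1 h2 h3 h4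
    rw [h4] at h3
    rw [h1, Pi.sub_apply, h2]
    exact sub_le_self _ (mul_nonneg hc0 h3)
  have h := hφ _ ((hMON hle).trans hη)
  rw [map_sub, map_smul, smul_eq_mul] at h
  have hcφ : c * φ W = -(u - φ η) := by
    have := hneg.ne
    rw [hc]
    field_simp
  linarith

/-- If `π X > Y` almost surely and the sublevel set `{π ≤ Y}` is nonempty, then in every set of
`𝒢` of positive probability there is a smaller one on which `Y` is a lower bound for `K(X, Q)`,
for some dual probability `Q`. -/
theorem exists_dualProbability_le_on [IsProbabilityMeasure P] (h𝒢 : 𝒢 ≤ mΩ)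
    (hLF : IsRandomLattice mΩ le_rfl LF) (hLG : IsRandomLattice 𝒢 h𝒢 LG)
    (hdual : ∀ φ ∈ orderContinuousDual LF, ∃ Z : Ω → ℝ, Represents LF Z φ)
    (hne : (dualProbabilities 𝒢 LF).Nonempty)
    {π : LF → LG} (hMON : Monotone π) (hQCO : IsCondQuasiconvex 𝒢 π)
    (hREG : IsRegular 𝒢 h𝒢 π) (hLSC : IsWeakLSC π) {X η : LF} {Y : LG} (hη : π η ≤ Y)
    (hXY : ∀ᵐ ω ∂P, (Y : Ω →ₘ[P] ℝ) ω < (π X : Ω →ₘ[P] ℝ) ω)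
    {B : Set Ω} (hB : MeasurableSet[𝒢] B) (hPB : P B ≠ 0) :
    ∃ D ⊆ B, MeasurableSet[𝒢] D ∧ P D ≠ 0 ∧ ∃ Q ∈ dualProbabilities 𝒢 LF, ∀ ξ : LF,
      Q[((X : Ω →ₘ[P] ℝ) : Ω → ℝ)|𝒢] ≤ᵐ[Q] Q[((ξ : Ω →ₘ[P] ℝ) : Ω → ℝ)|𝒢] →
        ∀ᵐ ω ∂P, ω ∈ D → (Y : Ω →ₘ[P] ℝ) ω ≤ (π ξ : Ω →ₘ[P] ℝ) ω := by
  -- Replacing `X` by `η` off `B` confines the separation to `B`: there `η ∈ C` trivially dominates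
  -- `x`, so `Bᶜ` falls into `U`.
  obtain ⟨x, hx, hπx⟩ := hREG.exists_glue hLF X η hB
  have hxC : x ∉ {ξ : LF | π ξ ≤ Y} := by
    intro h
    refine hPB (measure_eq_zero_iff_ae_notMem.2 ?_)
    filter_upwards [hπx, hXY, AEEqFun.coeFn_le.2 h] with ω h1 h2 h3 hω
    rw [h1.1 hω] at h3
    exact h3.not_gt h2
  obtain ⟨φ, hφ, u, hCu, hxu⟩ := exists_orderContinuous_separating (hQCO.convex_sublevel Y)
    (hLSC Y) hxC
  obtain ⟨Z₁, hZ₁⟩ := hdual φ hφ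
  obtain ⟨Z, hZm, hZ0, hZ⟩ := hZ₁.exists_nonneg hLF (nonneg_of_lt_on_sublevel hMON hη hCu)
  have hC := hREG.isGlueStable_sublevel hLF Y
  obtain ⟨U, hU, hPU, hUC⟩ := exists_condSeparated h𝒢 hZ hC ⟨η, hη⟩ hCu hxu
  set q : Ω → ℝ := P[Z|𝒢] with hq
  have hqm : Measurable[𝒢] q := stronglyMeasurable_condExp.measurable
  have hBc : P (Bᶜ \ U) = 0 := by
    refine hUC _ hB.compl η hη fun E hE hEm => le_of_eq ?_
    exact setIntegral_mul_congr h𝒢 Z hEm (hx.mono fun ω hω hωE => hω.2 (hE hωE))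
  -- Where `E[Z | 𝒢] ≤ 0`, the nonnegative `Z` vanishes almost surely, so `η` dominates `x` with
  -- both integrals zero.
  have hq0 : P ({ω | q ω ≤ 0} \ U) = 0 := by
    have hN : MeasurableSet[𝒢] {ω | q ω ≤ 0} := @measurableSet_le _ _ _ _ _ 𝒢 _ _ _ _ _ hqm
      measurable_const
    refine hUC _ hN η hη fun E hE hEm => le_of_eq ?_
    have h1 : ∫ ω in E, Z ω ∂P = 0 := by
      refine le_antisymm ?_ (integral_nonneg hZ0)
      rw [← setIntegral_condExp h𝒢 hZ.1 hEm]
      exact setIntegral_nonpos (h𝒢 E hEm) fun ω hω => hE hω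
    rw [setIntegral_eq_zero_iff_of_nonneg_ae (.of_forall hZ0) hZ.1.integrableOn,
      EventuallyEq, ae_restrict_iff' (h𝒢 E hEm)] at h1
    refine setIntegral_congr_ae (h𝒢 E hEm) ?_
    filter_upwards [h1] with ω hω hωE
    rw [hω hωE]
    simp
  let D : ℕ → Set Ω := fun n => (Uᶜ ∩ B) ∩ {ω | 1 / ((n : ℝ) + 1) < q ω}
  have hDm : ∀ n, MeasurableSet[𝒢] (D n) := fun n =>
    (hU.compl.inter hB).inter (@measurableSet_lt _ _ _ _ _ 𝒢 _ _ _ _ _ measurable_const hqm)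
  obtain ⟨n, hn⟩ : ∃ n, P (D n) ≠ 0 := by
    by_contra! hall
    refine hPU (measure_mono_null (t := (Bᶜ \ U) ∪ ({ω | q ω ≤ 0} \ U) ∪ ⋃ n, D n) ?_
      (measure_union_null (measure_union_null hBc hq0) (measure_iUnion_null hall)))
    intro ω hω
    by_cases hωB : ω ∈ B
    · rcases le_or_gt (q ω) 0 with hωq | hωq
      · exact .inl (.inr ⟨hωq, hω⟩)
      · obtain ⟨n, hn⟩ := exists_nat_one_div_lt hωq
        exact .inr (Set.mem_iUnion.2 ⟨n, ⟨hω, hωB⟩, hn⟩)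
    · exact .inl (.inl ⟨hωB, hω⟩)
  refine ⟨D n, fun ω hω => hω.1.2, hDm n, hn, ?_⟩
  obtain ⟨Q, hQ, hQd⟩ := exists_dualProbability_isDominatedOn h𝒢 hne hZm hZ0 ⟨φ, hφ, hZ⟩ (hDm n)
    (c := 1 / ((n : ℝ) + 1)) (by positivity) (fun ω hω => hω.2.le)
  refine ⟨Q, hQ, fun ξ hξ => ?_⟩
  have hd := hQd X ξ hξ
  have hYm := hLG.measurable _ Y.2
  have hξm := hLG.measurable _ (π ξ).2
  -- `𝒢`-measurable versions are compared so that `E` belongs to `𝒢` and gluing along it is allowed.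
  -- The element equal to `ξ` on `E` and to `η` elsewhere lies in `C` and dominates `x` on `E`,
  -- which forces `E \ U`, hence `E`, to be null.
  let E : Set Ω := {ω | hξm.mk _ ω < hYm.mk _ ω} ∩ D n
  have hE : MeasurableSet[𝒢] E := (@measurableSet_lt _ _ _ _ _ 𝒢 _ _ _ _ _
    hξm.stronglyMeasurable_mk.measurable hYm.stronglyMeasurable_mk.measurable).inter (hDm n)
  obtain ⟨W, hW, hπW⟩ := hREG.exists_glue hLF ξ η hE
  have hWC : π W ≤ Y := by
    change (π W : Ω →ₘ[P] ℝ) ≤ Y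
    rw [← AEEqFun.coeFn_le]
    filter_upwards [hπW, hξm.ae_eq_mk, hYm.ae_eq_mk, AEEqFun.coeFn_le.2 hη] with ω h1 h2 h3 h4
    by_cases hω : ω ∈ E
    · rw [h1.1 hω, h2, h3]
      exact (show _ < _ from hω.1).le
    · rw [h1.2 hω]
      exact h4
  have hPE : P (E \ U) = 0 := by
    refine hUC E hE W hWC fun E' hE' hE'm => ?_
    rw [setIntegral_mul_congr h𝒢 Z hE'm (hx.mono fun ω hω hωE => hω.1 (hE' hωE).2.1.2),
      setIntegral_mul_congr h𝒢 Z hE'm (hW.mono fun ω hω hωE => hω.1 (hE' hωE))]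
    exact hd E' (fun ω hω => (hE' hω).2) hE'm
  filter_upwards [measure_eq_zero_iff_ae_notMem.1 hPE, hξm.ae_eq_mk, hYm.ae_eq_mk]
    with ω h1 h2 h3 hω
  by_contra! hlt
  rw [h2, h3] at hlt
  exact h1 ⟨⟨hlt, hω⟩, hω.1.1⟩

/-- Extending `Y` by `⊥` off `D` turns the local bound into a global lower bound of the family. -/
theorem le_K_on [IsFiniteMeasure P] {π : LF → LG} {X : LF} {Q : Measure Ω} {Y : Ω →ₘ[P] ℝ}
    {D : Set Ω} (hD : MeasurableSet D)
    (h : ∀ ξ : LF, Q[((X : Ω →ₘ[P] ℝ) : Ω → ℝ)|𝒢] ≤ᵐ[Q] Q[((ξ : Ω →ₘ[P] ℝ) : Ω → ℝ)|𝒢] →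
        ∀ᵐ ω ∂P, ω ∈ D → Y ω ≤ (π ξ : Ω →ₘ[P] ℝ) ω) :
    ∀ᵐ ω ∂P, ω ∈ D → ((Y ω : ℝ) : EReal) ≤ K 𝒢 π X Q ω := by
  classical
  have hlm : Measurable (D.piecewise (fun ω => ((Y ω : ℝ) : EReal)) fun _ => ⊥) :=
    Measurable.piecewise hD (measurable_coe_real_ereal.comp Y.measurable) measurable_const
  have hle : AEEqFun.mk _ hlm.aestronglyMeasurable ≤ K 𝒢 π X Q := by
    refine (isGLB_essinf _).2 ?_
    rintro _ ⟨ξ, hξ, rfl⟩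
    rw [← AEEqFun.coeFn_le]
    filter_upwards [AEEqFun.coeFn_mk (μ := P) _ hlm.aestronglyMeasurable, h ξ hξ,
      AEEqFun.coeFn_comp (fun r : ℝ => (r : EReal)) continuous_coe_real_ereal
        (π ξ : Ω →ₘ[P] ℝ)] with ω h1 h2 h3
    rw [h1, toEReal, h3]
    by_cases hω : ω ∈ D
    · rw [Set.piecewise_eq_of_mem _ _ _ hω]
      exact EReal.coe_le_coe_iff.2 (h2 hω)
    · rw [Set.piecewise_eq_of_notMem _ _ _ hω]
      exact bot_le
  filter_upwards [AEEqFun.coeFn_le.2 hle, AEEqFun.coeFn_mk (μ := P) _ hlm.aestronglyMeasurable]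
    with ω h1 h2 hω
  rwa [h2, Set.piecewise_eq_of_mem _ _ _ hω] at h1

/-- A measurable set that is negligible on a part of positive probability of every non-null set of
`𝒢` is negligible. -/
theorem measure_eq_zero_of_forall_exists_subset [IsFiniteMeasure P] (h𝒢 : 𝒢 ≤ mΩ) {N : Set Ω}
    (hN : MeasurableSet N)
    (h : ∀ B, MeasurableSet[𝒢] B → P B ≠ 0 →
      ∃ D ⊆ B, MeasurableSet[𝒢] D ∧ P D ≠ 0 ∧ P (N ∩ D) = 0) : P N = 0 := by
  set f : Ω → ℝ := N.indicator fun _ => 1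
  have hf : Integrable f P := (integrable_const 1).indicator hN
  -- `N` need not belong to `𝒢`, so the hypothesis is applied to `{P(N | 𝒢) > 0}`. On a subset `D`
  -- of it, `P(N ∩ D) = 0` forces `P D = 0`.
  have hB : MeasurableSet[𝒢] {ω | 0 < (P[f|𝒢]) ω} := @measurableSet_lt _ _ _ _ _ 𝒢 _ _ _ _ _
    measurable_const stronglyMeasurable_condExp.measurable
  have hint : ∀ D, MeasurableSet[𝒢] D → ∫ ω in D, (P[f|𝒢]) ω ∂P = P.real (N ∩ D) := by
    intro D hD
    rw [setIntegral_condExp h𝒢 hf hD, setIntegral_indicator hN, Set.inter_comm]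
    simp
  have hPB : P {ω | 0 < (P[f|𝒢]) ω} = 0 := by
    by_contra hPB
    obtain ⟨D, hDB, hD, hPD, hND⟩ := h _ hB hPB
    have h0 := hint D hD
    rw [measureReal_def, hND, ENNReal.toReal_zero, setIntegral_eq_zero_iff_of_nonneg_ae
      ((ae_restrict_iff' (h𝒢 D hD)).2 (.of_forall fun ω hω => le_of_lt (hDB hω)))
      integrable_condExp.integrableOn, EventuallyEq, ae_restrict_iff' (h𝒢 D hD)] at h0
    refine hPD (measure_eq_zero_iff_ae_notMem.2 ?_)
    filter_upwards [h0] with ω h1 hω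
    exact ne_of_gt (hDB hω) (h1 hω)
  have huniv := hint Set.univ MeasurableSet.univ
  rw [Set.inter_univ, setIntegral_univ] at huniv
  have hle : ∫ ω, (P[f|𝒢]) ω ∂P ≤ 0 := by
    refine integral_nonpos_of_ae ?_
    filter_upwards [measure_eq_zero_iff_ae_notMem.1 hPB] with ω hω
    exact not_lt.1 hω
  rw [huniv] at hle
  exact (measureReal_eq_zero_iff).1 (le_antisymm hle measureReal_nonneg)

end Duality

end QuasiconvexDual

/-! ### The duality formula -/

open QuasiconvexDual in
theorem mainTheorem2 {Ω : Type*} (𝒢 : MeasurableSpace Ω) [mΩ : MeasurableSpace Ω]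
    (h𝒢 : 𝒢 ≤ mΩ) (P : Measure Ω) [IsProbabilityMeasure P]
    (LF LG : Submodule ℝ (Ω →ₘ[P] ℝ))
    (hLF : IsRandomLattice mΩ le_rfl LF) (hLG : IsRandomLattice 𝒢 h𝒢 LG)
    (hdual : ∀ φ ∈ orderContinuousDual LF, ∃ Z : Ω → ℝ, Represents LF Z φ)
    (hdual_ind : ∀ Z : Ω → ℝ, IsDualDensity LF Z →
      ∀ A : Set Ω, MeasurableSet A → IsDualDensity LF (A.indicator Z))
    (hsep : ∀ ξ : LF, (∀ φ ∈ orderContinuousDual LF, φ ξ = 0) → ξ = 0)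
    (hne : (dualProbabilities 𝒢 LF).Nonempty)
    (π : LF → LG) (hMON : Monotone π) (hQCO : IsCondQuasiconvex 𝒢 π)
    (hREG : IsRegular 𝒢 h𝒢 π) (hLSC : IsWeakLSC π)
    (X : LF)
    (hX : ∃ (η : LF) (δ : ℝ), 0 < δ ∧
      ∀ᵐ ω ∂P, (π η : Ω →ₘ[P] ℝ) ω + δ < (π X : Ω →ₘ[P] ℝ) ω) :
    toEReal (π X : Ω →ₘ[P] ℝ) = esssup {k | ∃ Q ∈ dualProbabilities 𝒢 LF, k = K 𝒢 π X Q} := by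
  set S : Set (Ω →ₘ[P] EReal) := {k | ∃ Q ∈ dualProbabilities 𝒢 LF, k = K 𝒢 π X Q}
  refine le_antisymm ?_ ((isLUB_esssup S).2 ?_)
  swap
  · rintro _ ⟨Q, -, rfl⟩
    exact (isGLB_essinf _).1 ⟨X, EventuallyLE.refl _ _, rfl⟩
  obtain ⟨η, δ, hδ, hηX⟩ := hX
  have hlt : ∀ᵐ ω ∂P, (π η : Ω →ₘ[P] ℝ) ω < (π X : Ω →ₘ[P] ℝ) ω := by
    filter_upwards [hηX] with ω hω
    linarith
  let t : ℕ → ℝ := fun n => 1 / ((n : ℝ) + 1)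
  have ht0 : ∀ n, 0 < t n := fun n => Nat.one_div_pos_of_nat
  have ht1 : ∀ n, t n ≤ 1 := fun n => by
    simpa [t] using Nat.one_div_le_one_div (α := ℝ) (Nat.zero_le n)
  -- Convex combinations of `π η` and `π X`, with `0 < t n ≤ 1`: they stay above `π η`, strictly
  -- below `π X`, and converge to `π X`.
  let Y : ℕ → LG := fun n => π X + t n • (π η - π X)
  have hY : ∀ n, ∀ᵐ ω ∂P, (Y n : Ω →ₘ[P] ℝ) ω = (π X : Ω →ₘ[P] ℝ) ω +
      t n * ((π η : Ω →ₘ[P] ℝ) ω - (π X : Ω →ₘ[P] ℝ) ω) := by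
    intro n
    filter_upwards [AEEqFun.coeFn_add (π X : Ω →ₘ[P] ℝ)
        (t n • ((π η : Ω →ₘ[P] ℝ) - (π X : Ω →ₘ[P] ℝ))),
      AEEqFun.coeFn_smul (t n) ((π η : Ω →ₘ[P] ℝ) - (π X : Ω →ₘ[P] ℝ)),
      AEEqFun.coeFn_sub (π η : Ω →ₘ[P] ℝ) (π X : Ω →ₘ[P] ℝ)] with ω h1 h2 h3
    refine h1.trans ?_
    rw [Pi.add_apply, h2, Pi.smul_apply, h3, Pi.sub_apply, smul_eq_mul]
  have hle : ∀ n, ∀ᵐ ω ∂P, (((Y n : Ω →ₘ[P] ℝ) ω : ℝ) : EReal) ≤ esssup S ω := by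
    intro n
    have hηY : π η ≤ Y n := by
      change (π η : Ω →ₘ[P] ℝ) ≤ Y n
      rw [← AEEqFun.coeFn_le]
      filter_upwards [hY n, hlt] with ω h1 h2
      rw [h1]
      nlinarith [ht1 n]
    have hYX : ∀ᵐ ω ∂P, (Y n : Ω →ₘ[P] ℝ) ω < (π X : Ω →ₘ[P] ℝ) ω := by
      filter_upwards [hY n, hlt] with ω h1 h2
      rw [h1]
      nlinarith [ht0 n]
    have hN : MeasurableSet {ω | esssup S ω < (((Y n : Ω →ₘ[P] ℝ) ω : ℝ) : EReal)} :=
      measurableSet_lt (esssup S).measurable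
        (measurable_coe_real_ereal.comp (Y n : Ω →ₘ[P] ℝ).measurable)
    have hPN := measure_eq_zero_of_forall_exists_subset (P := P) h𝒢 hN fun B hB hPB => by
      obtain ⟨D, hDB, hD, hPD, Q, hQ, hQξ⟩ := exists_dualProbability_le_on h𝒢 hLF hLG hdual hne
        hMON hQCO hREG hLSC hηY hYX hB hPB
      refine ⟨D, hDB, hD, hPD, measure_eq_zero_iff_ae_notMem.2 ?_⟩
      filter_upwards [le_K_on (h𝒢 D hD) hQξ,
        AEEqFun.coeFn_le.2 ((isLUB_esssup S).1 ⟨Q, hQ, rfl⟩)] with ω h1 h2 hω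
      exact ((h1 hω.2).trans h2).not_gt hω.1
    filter_upwards [measure_eq_zero_iff_ae_notMem.1 hPN] with ω hω
    exact not_lt.1 hω
  rw [← AEEqFun.coeFn_le]
  filter_upwards [AEEqFun.coeFn_comp (fun r : ℝ => (r : EReal)) continuous_coe_real_ereal
    (π X : Ω →ₘ[P] ℝ), ae_all_iff.2 hY, ae_all_iff.2 hle] with ω h1 h2 h3
  rw [toEReal, h1]
  have hlim : Tendsto (fun n => (Y n : Ω →ₘ[P] ℝ) ω) atTop (𝓝 ((π X : Ω →ₘ[P] ℝ) ω)) := by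
    simp only [h2]
    have := (tendsto_one_div_add_atTop_nhds_zero_nat (𝕜 := ℝ)).mul_const
      ((π η : Ω →ₘ[P] ℝ) ω - (π X : Ω →ₘ[P] ℝ) ω)
    simpa [t] using this.const_add ((π X : Ω →ₘ[P] ℝ) ω)
  exact le_of_tendsto' ((continuous_coe_real_ereal.tendsto _).comp hlim) h3
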